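/- **Setting.** Fix $K\in\mathbb N$ and let $\Delta_K=\{x\in[0,1]^K:\sum_{k}x_k=1\}$. Let $F_1,\dots,F_K:[0,1]\to[0,1]$ and $\mu\in[0,1]^K$; write $\langle m,F(x)\rangle=\sum_{k=1}^K m_kF_k(x_k)$. For $t=1,2,\dots$ let $G_{t,k}$ be $[0,1]$-valued rewards such that the vectors $(G_{t,1},\dots,G_{t,K})$ are independent over $t$ and, for each $k$, the $G_{t,k}$ are identically distributed with mean $\mu_k$. Let $B_{t,k}(x)\in\{0,1\}$, $x\in[0,1]$, be completion indicators with $\mathbb E[B_{t,k}(x)]=F_k(x)$, jointly measurable in $x$ and the noise of round $t$; the noises of different rounds are independent of each other and jointly independent of all rewards. (Dependence between tasks, and between budgets, within a round is arbitrary.) **Algorithm.** With horizon $T$ and $\delta\in(0,1)$, in each round $t=1,\dots,T$ the learner plays any $X_t\in\Delta_K$ maximizing $x\mapsto\langle \mathrm{UCB}_{t-1},F(x)\rangle$ over $\Delta_K$, where, with $N_{t,k}=\sum_{s\le t}B_{s,k}(X_{s,k})$ and $0/0:=0$, $$\mathrm{UCB}_{t,k}=\frac{\sum_{s\le t}B_{s,k}(X_{s,k})G_{s,k}}{N_{t,k}}+\sqrt{\frac{\log(2/\delta)}{1+N_{t,k}}}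 .$$ The regret is $R_T=T\sup_{x\in\Delta_K}\langle\mu,F(x)\rangle-\sum_{t=1}^T\mathbb E[\langle\mu,F(X_t)\rangle]$. **Theorem.** Suppose that, for every $k$, $\mu_k\neq 0$ and there is $a_k\in(0,1)$ with $F_k(x)=x^{a_k}$ for all $x\in[0,1]$. Then there is a constant $C$, depending only on $K$, $F$ and $\mu$, such that for every such environment and every horizon $T\ge2$, the algorithm run with $\delta=1/(KT)^2$ has well-defined expected rewards (each $\langle\mu,F(X_t)\rangle$ is integrable) and $$|R_T|\le C(\log T)^2 .$$ -/

import Mathlib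

open MeasureTheory ProbabilityTheory

/-- A *concave power function*: on `[0,1]` it is `x ↦ x ^ a` for some exponent `a ∈ (0,1)`. -/
def IsConcavePower (f : ℝ → ℝ) : Prop :=
  ∃ a ∈ Set.Ioo (0 : ℝ) 1, ∀ x ∈ Set.Icc (0 : ℝ) 1, f x = x ^ a

/-- The value `⟨m, F(x)⟩ = ∑ₖ mₖ Fₖ(xₖ)` of the allocation `x` under the reward vector `m`. -/
noncomputable def allocValue {K : ℕ} (m : Fin K → ℝ) (F : Fin K → ℝ → ℝ) (x : Fin K → ℝ) : ℝ :=
  ∑ k, m k * F k (x k)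

/-- The stochastic environment of the budget-allocation bandit with `K` tasks, budget-to-success
curves `F` and mean rewards `μ`.

Rounds are numbered from `0`. `G t k` is the reward attached to task `k` in round `t`.
The completion indicator of task `k` in round `t` under budget `x` is the random variable
`ω ↦ B t k x (ξ t ω)`, where `ξ t` is the completion noise of round `t`. The joint measurability
of `B t k` in budget and noise makes the indicator at a random budget a random variable.
Inside one round, the rewards of different tasks may be dependent, and so may be the completion
indicators of different tasks and of different budgets. -/
structure IsBudgetEnv {K : ℕ} {Ω S : Type*} [MeasurableSpace Ω] [MeasurableSpace S]
    (P : Measure Ω) (F : Fin K → ℝ → ℝ) (μ : Fin K → ℝ)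
    (G : ℕ → Fin K → Ω → ℝ) (ξ : ℕ → Ω → S) (B : ℕ → Fin K → ℝ → S → ℝ) : Prop where
  /-- rewards are random variables -/
  measurable_G : ∀ t k, Measurable (G t k)
  /-- rewards are `[0,1]`-valued -/
  G_mem : ∀ t k ω, G t k ω ∈ Set.Icc (0 : ℝ) 1
  /-- the reward vectors of different rounds are independent -/
  indep_G : iIndepFun (fun t ω k => G t k ω) P
  /-- the rewards of a task are identically distributed over the rounds -/
  ident_G : ∀ t k, IdentDistrib (G t k) (G 0 k) P P
  /-- task `k` has mean reward `μ k` -/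
  mean_G : ∀ k, ∫ ω, G 0 k ω ∂P = μ k
  /-- the completion noise is measurable -/
  measurable_ξ : ∀ t, Measurable (ξ t)
  /-- completion indicators are jointly measurable in budget and noise -/
  measurable_B : ∀ t k, Measurable (fun p : ℝ × S => B t k p.1 p.2)
  /-- completion indicators are `{0,1}`-valued -/
  B_mem : ∀ t k, ∀ x ∈ Set.Icc (0 : ℝ) 1, ∀ s, B t k x s = 0 ∨ B t k x s = 1
  /-- with budget `x`, task `k` is completed with probability `F k x` -/
  mean_B : ∀ t k, ∀ x ∈ Set.Icc (0 : ℝ) 1, ∫ ω, B t k x (ξ t ω) ∂P = F k x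
  /-- the completion indicators of different rounds are independent -/
  indep_ξ : iIndepFun ξ P
  /-- the completion indicators of all rounds are independent of the rewards of all rounds -/
  indep_ξ_G : IndepFun (fun ω t => ξ t ω) (fun ω t k => G t k ω) P

/-- The number of completions of task `k` in the first `t` rounds under the allocations `X`. -/
noncomputable def completions {K : ℕ} {Ω S : Type*} (ξ : ℕ → Ω → S)
    (B : ℕ → Fin K → ℝ → S → ℝ) (X : ℕ → Ω → Fin K → ℝ) (t : ℕ) (k : Fin K) (ω : Ω) : ℝ :=
  ∑ s ∈ Finset.range t, B s k (X s ω k) (ξ s ω)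

/-- The sum of the observed (i.e. unlocked) rewards of task `k` in the first `t` rounds. -/
noncomputable def collected {K : ℕ} {Ω S : Type*} (G : ℕ → Fin K → Ω → ℝ) (ξ : ℕ → Ω → S)
    (B : ℕ → Fin K → ℝ → S → ℝ) (X : ℕ → Ω → Fin K → ℝ) (t : ℕ) (k : Fin K) (ω : Ω) : ℝ :=
  ∑ s ∈ Finset.range t, B s k (X s ω k) (ξ s ω) * G s k ω

/-- The upper confidence bound for the mean reward of task `k` after `t` rounds. Without any
completion, division by zero makes the first term `0`, so the value is `√(log (2/δ))`. -/
noncomputable def ucb {K : ℕ} {Ω S : Type*} (δ : ℝ) (G : ℕ → Fin K → Ω → ℝ) (ξ : ℕ → Ω → S)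
    (B : ℕ → Fin K → ℝ → S → ℝ) (X : ℕ → Ω → Fin K → ℝ) (t : ℕ) (k : Fin K) (ω : Ω) : ℝ :=
  collected G ξ B X t k ω / completions ξ B X t k ω +
    Real.sqrt (Real.log (2 / δ) / (1 + completions ξ B X t k ω))

/-- `X` is a run of the optimistic algorithm with horizon `T` and confidence parameter `δ`: in each
round it plays an allocation in the simplex that maximizes the value under the current upper
confidence bounds (any maximizer may be chosen). -/
def IsUCBRun {K : ℕ} {Ω S : Type*} (T : ℕ) (δ : ℝ) (F : Fin K → ℝ → ℝ)
    (G : ℕ → Fin K → Ω → ℝ) (ξ : ℕ → Ω → S) (B : ℕ → Fin K → ℝ → S → ℝ)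
    (X : ℕ → Ω → Fin K → ℝ) : Prop :=
  ∀ t < T, ∀ ω, X t ω ∈ stdSimplex ℝ (Fin K) ∧
    IsMaxOn (allocValue (fun k => ucb δ G ξ B X t k ω) F) (stdSimplex ℝ (Fin K)) (X t ω)

/-- The regret after `T` rounds: `T · sup_{x ∈ Δ} ⟨μ, F(x)⟩ - ∑ₜ 𝔼[⟨μ, F(Xₜ)⟩]`. -/
noncomputable def regret {K : ℕ} {Ω : Type*} [MeasurableSpace Ω] (P : Measure Ω)
    (F : Fin K → ℝ → ℝ) (μ : Fin K → ℝ) (X : ℕ → Ω → Fin K → ℝ) (T : ℕ) : ℝ :=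
  T * sSup (allocValue μ F '' stdSimplex ℝ (Fin K)) -
    ∑ t ∈ Finset.range T, ∫ ω, allocValue μ F (X t ω) ∂P

/-! A power with exponent in (0,1) is strongly concave on [0,1] and has infinite slope at 0, so the
optimal allocation `x` has only positive coordinates. This makes the loss of a round quadratic in
the estimation errors (`value_gap_le`). If `u ≥ μ` and `y` is optimal for `u`, the loss of `y` is at
least a multiple of the squared distance to `x`, and at most `∑ (u - μ)(y ^ a - x ^ a)`. Only tasks
with `y k ≥ x k` contribute positively; there the tangent slope at `x k` is finite, AM-GM absorbs
the squared distance into half the loss, and `y ^ a / x ^ a ≥ 1` brings in the completion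
probability of `y`.

With `N` completions and `L = log (2/δ)` the squared error is at most `4 L / (1 + N)`. Allocations
are predictable, so in expectation a completion probability may be replaced by its indicator, and
the sum of `1 / (1 + N)` over completions is logarithmic (`sum_integral_div_le`). The second
logarithm is `L`.

Validity of the bounds comes from an exponential supermartingale and a union bound over the random
number of completions (`measureReal_badEvent_le`); failures cost at most 1 in total. -/

/-! ### Concavity estimates for powers -/

lemma rpow_midpoint_strong_concave {a x y : ℝ} (ha : a ∈ Set.Ioo (0 : ℝ) 1)
    (hx : x ∈ Set.Icc (0 : ℝ) 1) (hy : y ∈ Set.Icc (0 : ℝ) 1) :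
    (x ^ a + y ^ a) / 2 + a * (1 - a) / 8 * (x - y) ^ 2 ≤ ((x + y) / 2) ^ a := by
  obtain ⟨ha0, ha1⟩ := ha
  -- The second derivative is `a (1 - a) (1 - z ^ (a - 2)) ≤ 0` on (0,1). At a midpoint the square
  -- loses `(x - y) ^ 2 / 4`, which gives the constant `a (1 - a) / 8`.
  have hconc : ConcaveOn ℝ (Set.Icc (0 : ℝ) 1) (fun z : ℝ => z ^ a + a * (1 - a) / 2 * z ^ 2) := by
    apply concaveOn_of_hasDerivWithinAt2_nonpos (convex_Icc 0 1)
      (f' := fun z => a * z ^ (a - 1) + a * (1 - a) / 2 * (2 * z))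
      (f'' := fun z => a * ((a - 1) * z ^ (a - 1 - 1)) + a * (1 - a) / 2 * 2)
    · exact ((continuous_id.rpow_const fun _ => Or.inr ha0.le).add (by fun_prop)).continuousOn
    · intro z hz
      rw [interior_Icc] at hz
      have h1 := Real.hasDerivAt_rpow_const (x := z) (p := a) (Or.inl hz.1.ne')
      have h2 := (hasDerivAt_pow 2 z).const_mul (a * (1 - a) / 2)
      exact (h1.add h2).hasDerivWithinAt.congr_deriv (by norm_num)
    · intro z hz
      rw [interior_Icc] at hz
      have h1 := (Real.hasDerivAt_rpow_const (x := z) (p := a - 1) (Or.inl hz.1.ne')).const_mul a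
      have h2 := ((hasDerivAt_id z).const_mul 2).const_mul (a * (1 - a) / 2)
      exact (h1.add h2).hasDerivWithinAt.congr_deriv (by simp)
    · intro z hz
      rw [interior_Icc] at hz
      have : 1 ≤ z ^ (a - 1 - 1) :=
        Real.one_le_rpow_of_pos_of_le_one_of_nonpos hz.1 hz.2.le (by linarith)
      nlinarith [mul_pos ha0 (sub_pos.2 ha1)]
  have h := hconc.2 hx hy (by norm_num : (0 : ℝ) ≤ 1 / 2) (by norm_num : (0 : ℝ) ≤ 1 / 2)
    (by norm_num)
  simp only [smul_eq_mul] at h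
  have e : (1 / 2 : ℝ) * x + 1 / 2 * y = (x + y) / 2 := by ring
  rw [e] at h
  linarith [h]

lemma rpow_mul_rpow_sub_one {a b : ℝ} (ha : 0 < a) (hb : 0 ≤ b) : b ^ a = b ^ (a - 1) * b := by
  rcases hb.eq_or_lt with rfl | hb
  · rw [Real.zero_rpow ha.ne', mul_zero]
  · rw [← Real.rpow_add_one hb.ne', sub_add_cancel]

/-- Factor out `z ^ (a - 1)`, which decreases in `z`. The slope is larger than the derivative by a
factor `1 / a`, which is harmless here. -/
lemma rpow_sub_rpow_le_of_le {a b x : ℝ} (ha : a ∈ Set.Ioo (0 : ℝ) 1) (hb : 0 < b) (hbx : b ≤ x) :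
    x ^ a - b ^ a ≤ b ^ (a - 1) * (x - b) := by
  rw [rpow_mul_rpow_sub_one ha.1 hb.le, rpow_mul_rpow_sub_one ha.1 (hb.le.trans hbx)]
  have : x ^ (a - 1) ≤ b ^ (a - 1) := Real.rpow_le_rpow_of_nonpos hb hbx (by linarith [ha.2])
  nlinarith

lemma rpow_sub_rpow_le_of_ge {a b x : ℝ} (ha : a ∈ Set.Ioo (0 : ℝ) 1) (hx : 0 ≤ x) (hxb : x ≤ b) :
    b ^ a - x ^ a ≤ b ^ (a - 1) * (b - x) := by
  rw [rpow_mul_rpow_sub_one ha.1 (hx.trans hxb), rpow_mul_rpow_sub_one ha.1 hx]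
  rcases hx.eq_or_lt with rfl | hx
  · simp
  have : b ^ (a - 1) ≤ x ^ (a - 1) := Real.rpow_le_rpow_of_nonpos hx hxb (by linarith [ha.2])
  nlinarith

lemma mem_Icc_of_mem_simplex {ι : Type*} [Fintype ι] {x : ι → ℝ} (hx : x ∈ stdSimplex ℝ ι) (k : ι) :
    x k ∈ Set.Icc (0 : ℝ) 1 := mem_Icc_of_mem_stdSimplex hx k

/-- The value of an allocation under power functions with exponents `a`. -/
noncomputable def powerValue {ι : Type*} [Fintype ι] (a m x : ι → ℝ) : ℝ := ∑ k, m k * x k ^ a k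

lemma continuous_powerValue {ι : Type*} [Fintype ι] {a : ι → ℝ} (ha : ∀ k, a k ∈ Set.Ioo (0 : ℝ) 1) :
    Continuous fun p : (ι → ℝ) × (ι → ℝ) => powerValue a p.1 p.2 := by
  unfold powerValue
  refine continuous_finsetSum _ fun k _ => ?_
  exact (by fun_prop : Continuous fun p : (ι → ℝ) × (ι → ℝ) => p.1 k).mul
    ((by fun_prop : Continuous fun p : (ι → ℝ) × (ι → ℝ) => p.2 k).rpow_const
      fun _ => Or.inr (ha k).1.le)

/-! ### Maximizers over the simplex -/

section Simplex

variable {ι : Type*} [Fintype ι] {a m x y : ι → ℝ}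

/-- Testing maximality at the midpoint of `x` and `y` replaces any first-order condition at `x`. -/
lemma powerValue_midpoint (ha : ∀ k, a k ∈ Set.Ioo (0 : ℝ) 1) (hm : ∀ k, 0 ≤ m k)
    (hx : x ∈ stdSimplex ℝ ι) (hy : y ∈ stdSimplex ℝ ι)
    (hmax : IsMaxOn (powerValue a m) (stdSimplex ℝ ι) x) :
    ∑ k, m k * (a k * (1 - a k) / 4) * (x k - y k) ^ 2 ≤ powerValue a m x - powerValue a m y := by
  have hz : (1 / 2 : ℝ) • x + (1 / 2 : ℝ) • y ∈ stdSimplex ℝ ι :=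
    convex_stdSimplex ℝ ι hx hy (by norm_num) (by norm_num) (by norm_num)
  have h1 := hmax hz
  have h2 : (powerValue a m x + powerValue a m y) / 2
      + (∑ k, m k * (a k * (1 - a k) / 4) * (x k - y k) ^ 2) / 2
      ≤ powerValue a m ((1 / 2 : ℝ) • x + (1 / 2 : ℝ) • y) := by
    unfold powerValue
    rw [← Finset.sum_add_distrib, Finset.sum_div, Finset.sum_div, ← Finset.sum_add_distrib]
    refine Finset.sum_le_sum fun k _ => ?_
    have := mul_le_mul_of_nonneg_left (rpow_midpoint_strong_concave (ha k)
      (mem_Icc_of_mem_simplex hx k) (mem_Icc_of_mem_simplex hy k)) (hm k)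
    have e : ((1 / 2 : ℝ) • x + (1 / 2 : ℝ) • y) k = (x k + y k) / 2 := by
      simp; ring
    rw [e]
    refine le_trans (le_of_eq ?_) this
    ring
  have h1' : powerValue a m ((1 / 2 : ℝ) • x + (1 / 2 : ℝ) • y) ≤ powerValue a m x := h1
  linarith

lemma maximizer_unique (ha : ∀ k, a k ∈ Set.Ioo (0 : ℝ) 1) (hm : ∀ k, 0 < m k)
    (hx : x ∈ stdSimplex ℝ ι) (hy : y ∈ stdSimplex ℝ ι)
    (hmax : IsMaxOn (powerValue a m) (stdSimplex ℝ ι) x)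
    (hxy : powerValue a m x ≤ powerValue a m y) : x = y := by
  have h := powerValue_midpoint ha (fun k => (hm k).le) hx hy hmax
  have hc : ∀ k, 0 < m k * (a k * (1 - a k) / 4) := fun k =>
    mul_pos (hm k) (div_pos (mul_pos (ha k).1 (sub_pos.2 (ha k).2)) (by norm_num))
  have h0 : ∑ k, m k * (a k * (1 - a k) / 4) * (x k - y k) ^ 2 = 0 :=
    le_antisymm (by linarith) (Finset.sum_nonneg fun k _ => mul_nonneg (hc k).le (sq_nonneg _))
  rw [Finset.sum_eq_zero_iff_of_nonneg fun k _ => mul_nonneg (hc k).le (sq_nonneg _)] at h0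
  ext k
  have := h0 k (Finset.mem_univ k)
  rcases mul_eq_zero.1 this with h | h
  · exact absurd h (hc k).ne'
  · exact sub_eq_zero.1 (pow_eq_zero_iff two_ne_zero |>.1 h)

/-- The marginal value of a first bit of budget `e` is of order `e ^ (a k - 1)`, unbounded as `e →
0`, while taking it from a funded task costs at most a fixed rate. -/
lemma maximizer_pos (ha : ∀ k, a k ∈ Set.Ioo (0 : ℝ) 1) (hm : ∀ k, 0 < m k)
    (hx : x ∈ stdSimplex ℝ ι) (hmax : IsMaxOn (powerValue a m) (stdSimplex ℝ ι) x) (k : ι) :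
    0 < x k := by
  classical
  refine (hx.1 k).lt_of_ne' fun hk => ?_
  obtain ⟨j, hj⟩ : ∃ j, 0 < x j := by
    by_contra! hcon
    have := hx.2
    rw [Finset.sum_eq_zero fun j _ => le_antisymm (hcon j) (hx.1 j)] at this
    exact zero_ne_one this
  have hjk : j ≠ k := by rintro rfl; exact hj.ne' hk
  -- moving budget `e` from `j` to `k` cannot increase the value
  have key : ∀ e, 0 < e → e ≤ x j → m k * e ^ (a k - 1) ≤ m j * x j ^ (a j - 1) := by
    intro e he hej
    set z : ι → ℝ := Function.update (Function.update x j (x j - e)) k e with hz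
    have hzk : z k = e := by simp [hz]
    have hzj : z j = x j - e := by simp [hz, hjk]
    have hzo : ∀ i, i ≠ j → i ≠ k → z i = x i := fun i h1 h2 => by simp [hz, h1, h2]
    have hsum : ∀ f g : ι → ℝ, (∀ i, i ≠ j → i ≠ k → f i = g i) →
        ∑ i, f i - ∑ i, g i = (f j - g j) + (f k - g k) := by
      intro f g hfg
      rw [← Finset.sum_sub_distrib, ← Finset.sum_subset (Finset.subset_univ {j, k}),
        Finset.sum_pair hjk]
      intro i _ hi
      simp only [Finset.mem_insert, Finset.mem_singleton, not_or] at hi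
      rw [hfg i hi.1 hi.2, sub_self]
    have hzmem : z ∈ stdSimplex ℝ ι := by
      refine ⟨fun i => ?_, ?_⟩
      · by_cases hik : i = k
        · rw [hik, hzk]; exact he.le
        by_cases hij : i = j
        · rw [hij, hzj]; linarith
        · rw [hzo i hij hik]; exact hx.1 i
      · have := hsum z x hzo
        rw [hx.2, hzk, hzj, hk] at this
        linarith
    have hle : powerValue a m z ≤ powerValue a m x := hmax hzmem
    have hdiff := hsum (fun i => m i * z i ^ a i) (fun i => m i * x i ^ a i)
      (fun i h1 h2 => by rw [hzo i h1 h2])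
    simp only [hzk, hzj, hk, Real.zero_rpow (ha k).1.ne', mul_zero, sub_zero] at hdiff
    unfold powerValue at hle
    have hloss := rpow_sub_rpow_le_of_ge (ha j) (by linarith : 0 ≤ x j - e) (by linarith : x j - e ≤ x j)
    have hloss' := mul_le_mul_of_nonneg_left hloss (hm j).le
    rw [rpow_mul_rpow_sub_one (ha k).1 he.le] at hdiff
    have : m k * e ^ (a k - 1) * e ≤ m j * x j ^ (a j - 1) * e := by nlinarith
    exact le_of_mul_le_mul_right this he
  have hlim : Filter.Tendsto (fun e : ℝ => m k * e ^ (a k - 1)) (nhdsWithin 0 (Set.Ioi 0))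
      Filter.atTop :=
    Filter.Tendsto.const_mul_atTop (hm k)
      (tendsto_rpow_neg_nhdsGT_zero (by linarith [(ha k).2]))
  have h1 := hlim.eventually_gt_atTop (m j * x j ^ (a j - 1))
  have h2 : ∀ᶠ e in nhdsWithin (0 : ℝ) (Set.Ioi 0), e ∈ Set.Ioc 0 (x j) := Ioc_mem_nhdsGT hj
  obtain ⟨e, he1, he2⟩ := (h1.and h2).exists
  exact absurd (key e he2.1 he2.2) (not_le.2 he1)

/-- The weight of the squared overestimation of the mean reward of a task in the value gap. -/
noncomputable def gapWeight (a m x : ι → ℝ) (k : ι) : ℝ :=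
  (x k ^ (a k - 1)) ^ 2 / (m k * (a k * (1 - a k) / 4)) / x k ^ a k

lemma gapWeight_nonneg (ha : ∀ k, a k ∈ Set.Ioo (0 : ℝ) 1) (hm : ∀ k, 0 < m k)
    (hx : x ∈ stdSimplex ℝ ι) (k : ι) : 0 ≤ gapWeight a m x k := by
  have h1 := (ha k).1
  have h2 := sub_pos.2 (ha k).2
  have h3 := hm k
  have h4 := hx.1 k
  unfold gapWeight
  positivity

/-- A maximizer `y` of the value under optimistic rewards `u ≥ m` loses at most a weighted sum of the
*squares* of the overestimations `u - m`, each one multiplied by the completion probability. -/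
lemma value_gap_le {u : ι → ℝ} (ha : ∀ k, a k ∈ Set.Ioo (0 : ℝ) 1) (hm : ∀ k, 0 < m k)
    (hx : x ∈ stdSimplex ℝ ι) (hmax : IsMaxOn (powerValue a m) (stdSimplex ℝ ι) x)
    (hy : y ∈ stdSimplex ℝ ι) (hu : ∀ k, m k ≤ u k) (huy : powerValue a u x ≤ powerValue a u y) :
    powerValue a m x - powerValue a m y ≤
      ∑ k, gapWeight a m x k * (u k - m k) ^ 2 * y k ^ a k := by
  have hlow := powerValue_midpoint ha (fun k => (hm k).le) hx hy hmax
  -- The two sides differ by the gain of `y` over `x` under `u`, which is nonnegative.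
  have hup : powerValue a m x - powerValue a m y ≤ ∑ k, (u k - m k) * (y k ^ a k - x k ^ a k) := by
    have : ∑ k, (u k - m k) * (y k ^ a k - x k ^ a k) =
        powerValue a m x - powerValue a m y - (powerValue a u x - powerValue a u y) := by
      unfold powerValue
      simp only [← Finset.sum_sub_distrib]
      exact Finset.sum_congr rfl fun k _ => by ring
    linarith
  -- By `hlow` the quadratic terms, halved, sum to at most half of the gap and are absorbed on the
  -- left.
  have hterm : ∀ k, (u k - m k) * (y k ^ a k - x k ^ a k) ≤
      m k * (a k * (1 - a k) / 4) * (x k - y k) ^ 2 / 2 +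
        gapWeight a m x k * (u k - m k) ^ 2 * y k ^ a k / 2 := by
    intro k
    have hc : 0 < m k * (a k * (1 - a k) / 4) :=
      mul_pos (hm k) (div_pos (mul_pos (ha k).1 (sub_pos.2 (ha k).2)) (by norm_num))
    have hxk := maximizer_pos ha hm hx hmax k
    have hw := gapWeight_nonneg ha hm hx k
    have hyk : 0 ≤ y k ^ a k := Real.rpow_nonneg (hy.1 k) _
    have he : 0 ≤ u k - m k := sub_nonneg.2 (hu k)
    rcases le_total (y k) (x k) with hle | hle
    · have h1 : y k ^ a k ≤ x k ^ a k := Real.rpow_le_rpow (hy.1 k) hle (ha k).1.le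
      have : (u k - m k) * (y k ^ a k - x k ^ a k) ≤ 0 :=
        mul_nonpos_of_nonneg_of_nonpos he (by linarith)
      have : 0 ≤ gapWeight a m x k * (u k - m k) ^ 2 * y k ^ a k := by positivity
      have : 0 ≤ m k * (a k * (1 - a k) / 4) * (x k - y k) ^ 2 := by positivity
      linarith
    · have h1 : x k ^ a k ≤ y k ^ a k := Real.rpow_le_rpow (hx.1 k) hle (ha k).1.le
      have hxa : 0 < x k ^ a k := Real.rpow_pos_of_pos hxk _
      have h2 := mul_le_mul_of_nonneg_left (rpow_sub_rpow_le_of_le (ha k) hxk hle) he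
      set c := m k * (a k * (1 - a k) / 4) with hcdef
      set l := x k ^ (a k - 1)
      -- Since `y k ≥ x k`, the completion probability of `y` can be inserted at the price of
      -- dividing by that of `x`.
      have h3 : l ^ 2 / c * (u k - m k) ^ 2 ≤ gapWeight a m x k * (u k - m k) ^ 2 * y k ^ a k := by
        have : gapWeight a m x k * (u k - m k) ^ 2 * y k ^ a k =
            l ^ 2 / c * (u k - m k) ^ 2 * (y k ^ a k / x k ^ a k) := by
          unfold gapWeight; ring
        rw [this]
        exact le_mul_of_one_le_right (by positivity) ((one_le_div hxa).2 h1)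
      have h4 : (u k - m k) * (l * (y k - x k)) ≤
          c * (x k - y k) ^ 2 / 2 + l ^ 2 / c * (u k - m k) ^ 2 / 2 := by
        have : c * (x k - y k) ^ 2 / 2 + l ^ 2 / c * (u k - m k) ^ 2 / 2
            - (u k - m k) * (l * (y k - x k)) = (c * (y k - x k) - l * (u k - m k)) ^ 2 / (2 * c) := by
          field_simp; ring
        have : 0 ≤ (c * (y k - x k) - l * (u k - m k)) ^ 2 / (2 * c) := by positivity
        linarith
      linarith
  have hsum := Finset.sum_le_sum fun k (_ : k ∈ Finset.univ) => hterm k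
  rw [Finset.sum_add_distrib, ← Finset.sum_div, ← Finset.sum_div] at hsum
  linarith

/-- A map that picks maximizers of the value under measurable positive rewards is measurable. -/
lemma measurable_maximizer {Ω : Type*} [MeasurableSpace Ω] (ha : ∀ k, a k ∈ Set.Ioo (0 : ℝ) 1)
    {u X : Ω → ι → ℝ} (hu : Measurable u) (hpos : ∀ ω k, 0 < u ω k)
    (hX : ∀ ω, X ω ∈ stdSimplex ℝ ι)
    (hmax : ∀ ω, IsMaxOn (powerValue a (u ω)) (stdSimplex ℝ ι) (X ω)) : Measurable X := by
  have hval : Continuous fun p : (ι → ℝ) × (ι → ℝ) => powerValue a p.1 p.2 :=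
    continuous_powerValue ha
  refine measurable_of_isClosed fun s hs => ?_
  have hcomp : IsCompact (stdSimplex ℝ ι ∩ s) := (isCompact_stdSimplex ℝ ι).inter_right hs
  rcases (stdSimplex ℝ ι ∩ s).eq_empty_or_nonempty with hemp | hne
  · have : X ⁻¹' s = ∅ := Set.eq_empty_of_forall_notMem fun ω hω =>
      Set.eq_empty_iff_forall_notMem.1 hemp (X ω) ⟨hX ω, hω⟩
    rw [this]; exact MeasurableSet.empty
  have hv1 : Continuous fun w => sSup (powerValue a w '' (stdSimplex ℝ ι ∩ s)) :=
    hcomp.continuous_sSup hval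
  have hv2 : Continuous fun w => sSup (powerValue a w '' stdSimplex ℝ ι) :=
    (isCompact_stdSimplex ℝ ι).continuous_sSup hval
  have hcont : ∀ w, Continuous (powerValue a w) := fun w =>
    hval.comp (Continuous.prodMk_right w)
  have hbdd : ∀ w, BddAbove (powerValue a w '' stdSimplex ℝ ι) := fun w =>
    ((isCompact_stdSimplex ℝ ι).image (hcont w)).bddAbove
  -- By uniqueness of the maximizer, `X ω` lies in `s` exactly when restricting to `s` does not
  -- lower the maximum; both maxima are continuous in the rewards.
  have : X ⁻¹' s = {ω | sSup (powerValue a (u ω) '' stdSimplex ℝ ι) ≤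
      sSup (powerValue a (u ω) '' (stdSimplex ℝ ι ∩ s))} := by
    ext ω
    simp only [Set.mem_preimage, Set.mem_ofPred_eq]
    constructor
    · intro hω
      refine csSup_le ⟨_, X ω, hX ω, rfl⟩ ?_
      rintro _ ⟨z, hz, rfl⟩
      exact (hmax ω hz).trans (le_csSup ((hbdd _).mono (Set.image_mono Set.inter_subset_left))
        ⟨X ω, ⟨hX ω, hω⟩, rfl⟩)
    · intro hω
      obtain ⟨z, hz, hzs⟩ := hcomp.exists_sSup_image_eq hne (hcont (u ω)).continuousOn
      have : powerValue a (u ω) (X ω) ≤ powerValue a (u ω) z := by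
        rw [← hzs]; exact (le_csSup (hbdd _) ⟨X ω, hX ω, rfl⟩).trans hω
      rw [maximizer_unique ha (hpos ω) (hX ω) hz.1 (hmax ω) this]
      exact hz.2
  rw [this]
  exact measurableSet_le (hv2.measurable.comp hu) (hv1.measurable.comp hu)

end Simplex

/-! ### A logarithmic increment and a chain rule for independence -/

/-- From `log z ≥ 1 - 1 / z`, the increment is at least `1 / (n + 2)`, hence at least `1 / (2 (n +
1))`. -/
lemma inv_one_add_le_log_sub {n : ℝ} (hn : 0 ≤ n) :
    1 / (1 + n) ≤ 2 * (Real.log (1 + (n + 1)) - Real.log (1 + n)) := by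
  rw [← Real.log_div (by positivity) (by positivity)]
  have h := Real.one_sub_inv_le_log_of_pos (x := (1 + (n + 1)) / (1 + n)) (by positivity)
  have : 1 / (1 + n) ≤ 2 * (1 - ((1 + (n + 1)) / (1 + n))⁻¹) := by
    rw [inv_div, one_sub_div (by positivity), ← mul_div_assoc, div_le_div_iff₀ (by positivity) (by positivity)]
    nlinarith
  linarith

lemma indepFun_prodMk_of_indepFun {Ω α β γ : Type*} [MeasurableSpace Ω] [MeasurableSpace α]
    [MeasurableSpace β] [MeasurableSpace γ] {P : Measure Ω} [IsProbabilityMeasure P]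
    {X : Ω → α} {Y : Ω → β} {Z : Ω → γ} (hX : Measurable X) (hY : Measurable Y) (hZ : Measurable Z)
    (h : IndepFun X (fun ω => (Y ω, Z ω)) P) (h' : IndepFun Y Z P) :
    IndepFun (fun ω => (X ω, Y ω)) Z P := by
  have := Measure.isProbabilityMeasure_map (μ := P) hX.aemeasurable
  have := Measure.isProbabilityMeasure_map (μ := P) hY.aemeasurable
  have := Measure.isProbabilityMeasure_map (μ := P) hZ.aemeasurable
  have hXY : IndepFun X Y P := h.comp measurable_id measurable_fst
  rw [indepFun_iff_map_prod_eq_prod_map_map hX.aemeasurable (hY.prodMk hZ).aemeasurable] at h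
  rw [indepFun_iff_map_prod_eq_prod_map_map hY.aemeasurable hZ.aemeasurable] at h'
  rw [indepFun_iff_map_prod_eq_prod_map_map hX.aemeasurable hY.aemeasurable] at hXY
  rw [indepFun_iff_map_prod_eq_prod_map_map (hX.prodMk hY).aemeasurable hZ.aemeasurable, hXY]
  apply MeasurableEquiv.prodAssoc.map_measurableEquiv_injective
  rw [Measure.prodAssoc_prod, ← h', ← h, Measure.map_map (by fun_prop) (by fun_prop)]
  rfl

/-! ### The filtration of rewards and noise -/

section Past

variable {K : ℕ} {Ω S : Type*} [MeasurableSpace S] {G : ℕ → Fin K → Ω → ℝ} {ξ : ℕ → Ω → S}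

/-- The rewards and the completion noise of the first `t` rounds. -/
def pastData (G : ℕ → Fin K → Ω → ℝ) (ξ : ℕ → Ω → S) (t : ℕ) (ω : Ω) :
    (Finset.range t → Fin K → ℝ) × (Finset.range t → S) :=
  (fun s k => G s k ω, fun s => ξ s ω)

/-- The information available before round `t`. -/
abbrev past (G : ℕ → Fin K → Ω → ℝ) (ξ : ℕ → Ω → S) (t : ℕ) : MeasurableSpace Ω :=
  MeasurableSpace.comap (pastData G ξ t) inferInstance

/-- The information available before round `t`, and the completion noise of round `t`. -/
abbrev pastWithNoise (G : ℕ → Fin K → Ω → ℝ) (ξ : ℕ → Ω → S) (t : ℕ) : MeasurableSpace Ω :=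
  MeasurableSpace.comap (fun ω => (pastData G ξ t ω, ξ t ω)) inferInstance

lemma measurable_pastData_past (t : ℕ) : Measurable[past G ξ t] (pastData G ξ t) :=
  comap_measurable _

lemma measurable_noise_past {s t : ℕ} (hst : s < t) : Measurable[past G ξ t] (ξ s) :=
  ((measurable_pi_apply (⟨s, Finset.mem_range.2 hst⟩ : Finset.range t)).comp measurable_snd).comp
    (measurable_pastData_past t)

lemma measurable_reward_past {s t : ℕ} (hst : s < t) (k : Fin K) :
    Measurable[past G ξ t] (G s k) :=
  have h : Measurable fun p : (Finset.range t → Fin K → ℝ) × (Finset.range t → S) =>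
    p.1 ⟨s, Finset.mem_range.2 hst⟩ k := by fun_prop
  h.comp (measurable_pastData_past t)

lemma past_mono {s t : ℕ} (hst : s ≤ t) : past G ξ s ≤ past G ξ t := by
  have hsub : ∀ r : Finset.range s, (r : ℕ) ∈ Finset.range t := fun r =>
    Finset.mem_range.2 ((Finset.mem_range.1 r.2).trans_le hst)
  have h : Measurable fun p : (Finset.range t → Fin K → ℝ) × (Finset.range t → S) =>
    ((fun r : Finset.range s => p.1 ⟨r, hsub r⟩), fun r : Finset.range s => p.2 ⟨r, hsub r⟩) := by
      fun_prop
  exact Measurable.comap_le (h.comp (measurable_pastData_past t))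

lemma past_le_pastWithNoise (t : ℕ) : past G ξ t ≤ pastWithNoise G ξ t :=
  Measurable.comap_le (measurable_fst.comp (comap_measurable _))

lemma measurable_noise_pastWithNoise (t : ℕ) : Measurable[pastWithNoise G ξ t] (ξ t) :=
  measurable_snd.comp (comap_measurable fun ω => (pastData G ξ t ω, ξ t ω))

lemma measurable_indicator_of_measurable {m : MeasurableSpace Ω} {b : ℝ → S → ℝ} {x : Ω → Fin K → ℝ}
    {η : Ω → S} (hb : Measurable fun p : ℝ × S => b p.1 p.2) {k : Fin K} (hx : Measurable x)
    (hη : Measurable η) : Measurable fun ω => b (x ω k) (η ω) :=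
  hb.comp (((measurable_pi_apply k).comp hx).prodMk hη)

end Past

/-! ### Predictability of the allocations and conditional completion probabilities -/

section Environment

variable {K : ℕ} {Ω S : Type*} [MeasurableSpace Ω] [MeasurableSpace S] {P : Measure Ω}
  {F : Fin K → ℝ → ℝ} {μ : Fin K → ℝ} {G : ℕ → Fin K → Ω → ℝ}
  {ξ : ℕ → Ω → S} {B : ℕ → Fin K → ℝ → S → ℝ} {X : ℕ → Ω → Fin K → ℝ}

lemma measurable_pastData (henv : IsBudgetEnv P F μ G ξ B) (t : ℕ) : Measurable (pastData G ξ t) :=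
  Measurable.prodMk
    (measurable_pi_lambda _ fun s => measurable_pi_lambda _ fun k => henv.measurable_G s k)
    (measurable_pi_lambda _ fun s => henv.measurable_ξ s)

lemma past_le (henv : IsBudgetEnv P F μ G ξ B) (t : ℕ) : past G ξ t ≤ ‹MeasurableSpace Ω› :=
  (measurable_pastData henv t).comap_le

lemma measurable_completions_past (henv : IsBudgetEnv P F μ G ξ B) {t : ℕ}
    (hX : ∀ s < t, Measurable[past G ξ s] (X s)) (k : Fin K) :
    Measurable[past G ξ t] (completions ξ B X t k) := by
  refine Finset.measurable_sum _ fun s hs => ?_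
  have hst := Finset.mem_range.1 hs
  exact measurable_indicator_of_measurable (henv.measurable_B s k) ((hX s hst).mono (past_mono hst.le) le_rfl)
    (measurable_noise_past hst)

lemma measurable_collected_past (henv : IsBudgetEnv P F μ G ξ B) {t : ℕ}
    (hX : ∀ s < t, Measurable[past G ξ s] (X s)) (k : Fin K) :
    Measurable[past G ξ t] (collected G ξ B X t k) := by
  refine Finset.measurable_sum _ fun s hs => ?_
  have hst := Finset.mem_range.1 hs
  exact (measurable_indicator_of_measurable (henv.measurable_B s k) ((hX s hst).mono (past_mono hst.le) le_rfl)
    (measurable_noise_past hst)).mul (measurable_reward_past hst k)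

lemma measurable_ucb_past (henv : IsBudgetEnv P F μ G ξ B) {t : ℕ} (δ : ℝ)
    (hX : ∀ s < t, Measurable[past G ξ s] (X s)) (k : Fin K) :
    Measurable[past G ξ t] (ucb δ G ξ B X t k) := by
  have h1 := measurable_completions_past henv hX k
  exact ((measurable_collected_past henv hX k).div h1).add
    ((h1.const_add 1).const_div _).sqrt

lemma indicator_mem (henv : IsBudgetEnv P F μ G ξ B) {s : ℕ}
    (hX : ∀ ω, X s ω ∈ stdSimplex ℝ (Fin K)) (k : Fin K) (ω : Ω) :
    B s k (X s ω k) (ξ s ω) = 0 ∨ B s k (X s ω k) (ξ s ω) = 1 :=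
  henv.B_mem s k _ (mem_Icc_of_mem_simplex (hX ω) k) _

lemma exists_completions_eq_natCast (henv : IsBudgetEnv P F μ G ξ B) {t : ℕ}
    (hX : ∀ s < t, ∀ ω, X s ω ∈ stdSimplex ℝ (Fin K)) (k : Fin K) (ω : Ω) :
    ∃ n ≤ t, completions ξ B X t k ω = n := by
  induction t with
  | zero => exact ⟨0, le_rfl, by simp [completions]⟩
  | succ t ih =>
    obtain ⟨n, hn, h⟩ := ih fun s hs => hX s (hs.trans t.lt_succ_self)
    have hsucc : completions ξ B X (t + 1) k ω = n + B t k (X t ω k) (ξ t ω) := by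
      rw [← h]; exact Finset.sum_range_succ _ _
    rcases indicator_mem henv (hX t t.lt_succ_self) k ω with h0 | h1
    · exact ⟨n, by omega, by rw [hsucc, h0, add_zero]⟩
    · exact ⟨n + 1, by omega, by rw [hsucc, h1]; push_cast; rfl⟩

lemma completions_nonneg (henv : IsBudgetEnv P F μ G ξ B) {t : ℕ}
    (hX : ∀ s < t, ∀ ω, X s ω ∈ stdSimplex ℝ (Fin K)) (k : Fin K) (ω : Ω) :
    0 ≤ completions ξ B X t k ω := by
  obtain ⟨n, -, h⟩ := exists_completions_eq_natCast henv hX k ω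
  rw [h]; exact n.cast_nonneg

/-- Strict positivity, supplied by the exploration bonus, makes the maximizer unique and hence
measurable. -/
lemma ucb_pos (henv : IsBudgetEnv P F μ G ξ B) {t : ℕ} {δ : ℝ} (hδ : 0 < Real.log (2 / δ))
    (hX : ∀ s < t, ∀ ω, X s ω ∈ stdSimplex ℝ (Fin K)) (k : Fin K) (ω : Ω) :
    0 < ucb δ G ξ B X t k ω := by
  have h1 := completions_nonneg henv hX k ω
  have h2 : 0 ≤ collected G ξ B X t k ω := Finset.sum_nonneg fun s hs => by
    have h3 := (henv.G_mem s k ω).1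
    rcases indicator_mem henv (hX s (Finset.mem_range.1 hs)) k ω with h | h <;> rw [h] <;> linarith
  unfold ucb
  positivity

lemma allocValue_eq_powerValue {a : Fin K → ℝ}
    (hF : ∀ k, ∀ x ∈ Set.Icc (0 : ℝ) 1, F k x = x ^ a k) (m : Fin K → ℝ) {x : Fin K → ℝ}
    (hx : x ∈ stdSimplex ℝ (Fin K)) : allocValue m F x = powerValue a m x :=
  Finset.sum_congr rfl fun k _ => by rw [hF k _ (mem_Icc_of_mem_simplex hx k)]

lemma isMaxOn_powerValue {a : Fin K → ℝ}
    (hF : ∀ k, ∀ x ∈ Set.Icc (0 : ℝ) 1, F k x = x ^ a k) {m : Fin K → ℝ} {x : Fin K → ℝ}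
    (hx : x ∈ stdSimplex ℝ (Fin K)) (h : IsMaxOn (allocValue m F) (stdSimplex ℝ (Fin K)) x) :
    IsMaxOn (powerValue a m) (stdSimplex ℝ (Fin K)) x := by
  intro y hy
  have := h hy
  simpa only [Set.mem_ofPred_eq, allocValue_eq_powerValue hF m hx, allocValue_eq_powerValue hF m hy]
    using this

/-- The allocations of the algorithm are predictable. -/
lemma measurable_allocation_past {a : Fin K → ℝ} (ha : ∀ k, a k ∈ Set.Ioo (0 : ℝ) 1)
    (hF : ∀ k, ∀ x ∈ Set.Icc (0 : ℝ) 1, F k x = x ^ a k) (henv : IsBudgetEnv P F μ G ξ B)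
    {T : ℕ} {δ : ℝ} (hδ : 0 < Real.log (2 / δ)) (hrun : IsUCBRun T δ F G ξ B X) :
    ∀ t < T, Measurable[past G ξ t] (X t) := by
  intro t
  induction t using Nat.strong_induction_on with
  | _ t ih =>
    intro ht
    -- The lemma is used with `past G ξ t` as σ-algebra, so that measurability means predictability.
    refine @measurable_maximizer _ _ _ Ω (past G ξ t) ha (fun ω k => ucb δ G ξ B X t k ω) (X t)
      ?_ ?_ (fun ω => (hrun t ht ω).1) (fun ω => isMaxOn_powerValue hF (hrun t ht ω).1 (hrun t ht ω).2)
    · exact @measurable_pi_lambda _ _ _ (past G ξ t) _ _ fun k =>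
        measurable_ucb_past henv δ (fun s hs => ih s hs (hs.trans ht)) k
    · exact fun ω k => ucb_pos henv hδ (fun s hs ω => (hrun s (hs.trans ht) ω).1) k ω

variable [IsProbabilityMeasure P]

lemma indepFun_pastData_noise (henv : IsBudgetEnv P F μ G ξ B) (t : ℕ) :
    IndepFun (pastData G ξ t) (ξ t) P := by
  have hG : Measurable fun ω (s : Finset.range t) k => G s k ω :=
    measurable_pi_lambda _ fun s => measurable_pi_lambda _ fun k => henv.measurable_G s k
  have hξ : Measurable fun ω (s : Finset.range t) => ξ s ω :=
    measurable_pi_lambda _ fun s => henv.measurable_ξ s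
  refine indepFun_prodMk_of_indepFun hG hξ (henv.measurable_ξ t) ?_ ?_
  · exact henv.indep_ξ_G.symm.comp
      (φ := fun g (s : Finset.range t) => g s)
      (ψ := fun x => (fun s : Finset.range t => x s, x t)) (by fun_prop) (by fun_prop)
  · exact (henv.indep_ξ.indepFun_finset (Finset.range t) {t} (by simp) henv.measurable_ξ).comp
      measurable_id (measurable_pi_apply (⟨t, Finset.mem_singleton_self t⟩ : ({t} : Finset ℕ)))

/-- The current noise belongs to the conditioning because it decides whether the reward is observed.
-/
lemma indepFun_pastWithNoise_reward (henv : IsBudgetEnv P F μ G ξ B) (t : ℕ) :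
    IndepFun (fun ω => (pastData G ξ t ω, ξ t ω)) (fun ω k => G t k ω) P := by
  have hGt : ∀ t, Measurable fun ω k => G t k ω :=
    fun t => measurable_pi_lambda _ fun k => henv.measurable_G t k
  have hG : Measurable fun ω (s : Finset.range t) k => G s k ω :=
    measurable_pi_lambda _ fun s => hGt s
  have hξ : Measurable fun ω s => ξ s ω := measurable_pi_lambda _ fun s => henv.measurable_ξ s
  have h := indepFun_prodMk_of_indepFun (P := P) hξ hG (hGt t) ?_ ?_
  · exact h.comp (φ := fun p : (ℕ → S) × (Finset.range t → Fin K → ℝ) =>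
      ((p.2, fun s : Finset.range t => p.1 s), p.1 t)) (by fun_prop) measurable_id
  · exact henv.indep_ξ_G.comp
      (ψ := fun x => (fun s : Finset.range t => x s, x t)) measurable_id (by fun_prop)
  · exact (henv.indep_G.indepFun_finset (Finset.range t) {t} (by simp) hGt).comp
      measurable_id (measurable_pi_apply (⟨t, Finset.mem_singleton_self t⟩ : ({t} : Finset ℕ)))

lemma indepFun_of_measurable_past (henv : IsBudgetEnv P F μ G ξ B) {t : ℕ} {β : Type*}
    [MeasurableSpace β] {f : Ω → β} (hf : Measurable[past G ξ t] f) : IndepFun f (ξ t) P :=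
  indep_of_indep_of_le_left (indepFun_pastData_noise henv t) hf.comap_le

lemma indepFun_of_measurable_pastWithNoise (henv : IsBudgetEnv P F μ G ξ B) {t : ℕ} {β : Type*}
    [MeasurableSpace β] {f : Ω → β} (hf : Measurable[pastWithNoise G ξ t] f) (k : Fin K) :
    IndepFun f (G t k) P :=
  have h : IndepFun (fun ω => (pastData G ξ t ω, ξ t ω)) (G t k) P :=
    (indepFun_pastWithNoise_reward henv t).comp measurable_id (measurable_pi_apply k)
  indep_of_indep_of_le_left h hf.comap_le

/-- Given the past, a task is completed with probability `F k` of the budget it receives. -/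
lemma integral_mul_indicator (henv : IsBudgetEnv P F μ G ξ B) {t : ℕ} {k : Fin K} {w : Ω → ℝ} {C : ℝ}
    (hw : Measurable[past G ξ t] w) (hwC : ∀ ω, |w ω| ≤ C) (hX : Measurable[past G ξ t] (X t))
    (hXmem : ∀ ω, X t ω ∈ stdSimplex ℝ (Fin K)) :
    ∫ ω, w ω * B t k (X t ω k) (ξ t ω) ∂P = ∫ ω, w ω * F k (X t ω k) ∂P := by
  have hle := past_le henv t
  have hV : Measurable[past G ξ t] fun ω => (w ω, X t ω k) :=
    hw.prodMk ((measurable_pi_apply k).comp hX)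
  have hV' : Measurable fun ω => (w ω, X t ω k) := hV.mono hle le_rfl
  have hind := indepFun_of_measurable_past henv hV
  rw [indepFun_iff_map_prod_eq_prod_map_map hV'.aemeasurable (henv.measurable_ξ t).aemeasurable]
    at hind
  have := Measure.isProbabilityMeasure_map (μ := P) hV'.aemeasurable
  have := Measure.isProbabilityMeasure_map (μ := P) (henv.measurable_ξ t).aemeasurable
  have hφ : Measurable fun p : (ℝ × ℝ) × S => p.1.1 * B t k p.1.2 p.2 :=
    (measurable_fst.comp measurable_fst).mul ((henv.measurable_B t k).comp
      ((measurable_snd.comp measurable_fst).prodMk measurable_snd))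
  have hpair : Measurable fun ω => ((w ω, X t ω k), ξ t ω) := hV'.prodMk (henv.measurable_ξ t)
  have hint : Integrable (fun p : (ℝ × ℝ) × S => p.1.1 * B t k p.1.2 p.2)
      (P.map fun ω => ((w ω, X t ω k), ξ t ω)) := by
    rw [integrable_map_measure hφ.aestronglyMeasurable hpair.aemeasurable]
    refine Integrable.of_bound (hφ.comp hpair).aestronglyMeasurable C
      (Filter.Eventually.of_forall fun ω => ?_)
    have := (abs_nonneg _).trans (hwC ω)
    rcases indicator_mem henv hXmem k ω with h | h <;> simp [h, this, hwC ω]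
  calc ∫ ω, w ω * B t k (X t ω k) (ξ t ω) ∂P
      = ∫ p, p.1.1 * B t k p.1.2 p.2 ∂(P.map fun ω => ((w ω, X t ω k), ξ t ω)) :=
        (integral_map hpair.aemeasurable hφ.aestronglyMeasurable).symm
    -- Independence makes the joint law a product, so the noise is integrated out with weight and
    -- budget frozen.
    _ = ∫ v, ∫ x, v.1 * B t k v.2 x ∂(P.map (ξ t)) ∂(P.map fun ω => (w ω, X t ω k)) := by
        rw [hind] at hint ⊢
        exact integral_prod _ hint
    _ = ∫ ω, ∫ x, w ω * B t k (X t ω k) x ∂(P.map (ξ t)) ∂P := by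
        refine integral_map hV'.aemeasurable ?_
        exact (hφ.stronglyMeasurable.integral_prod_right').aestronglyMeasurable
    _ = ∫ ω, w ω * F k (X t ω k) ∂P := by
        refine integral_congr_ae (Filter.Eventually.of_forall fun ω => ?_)
        have hB : Measurable (B t k (X t ω k)) :=
          (henv.measurable_B t k).comp measurable_prodMk_left
        simp only
        rw [integral_const_mul, integral_map (henv.measurable_ξ t).aemeasurable
          hB.aestronglyMeasurable, henv.mean_B t k _ (mem_Icc_of_mem_simplex (hXmem ω) k)]

end Environment

/-! ### Concentration of the collected rewards -/

section Concentration

variable {K : ℕ} {Ω S : Type*} [MeasurableSpace Ω] [MeasurableSpace S] {P : Measure Ω}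
  {F : Fin K → ℝ → ℝ} {μ : Fin K → ℝ} {G : ℕ → Fin K → Ω → ℝ}
  {ξ : ℕ → Ω → S} {B : ℕ → Fin K → ℝ → S → ℝ} {X : ℕ → Ω → Fin K → ℝ}

lemma mean_mem_Icc [IsProbabilityMeasure P] (henv : IsBudgetEnv P F μ G ξ B) (k : Fin K) :
    μ k ∈ Set.Icc (0 : ℝ) 1 := by
  have hint : Integrable (G 0 k) P := Integrable.of_mem_Icc 0 1
    (henv.measurable_G 0 k).aemeasurable (Filter.Eventually.of_forall (henv.G_mem 0 k))
  rw [← henv.mean_G k]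
  refine ⟨integral_nonneg fun ω => (henv.G_mem 0 k ω).1, ?_⟩
  have := integral_mono hint (integrable_const (1 : ℝ)) fun ω => (henv.G_mem 0 k ω).2
  simpa using this

/-- Hoeffding's lemma: a [0,1]-valued variable is sub-Gaussian with variance proxy 1/4. -/
lemma integral_exp_reward_le [IsProbabilityMeasure P] (henv : IsBudgetEnv P F μ G ξ B) (t : ℕ)
    (k : Fin K) (l : ℝ) :
    Integrable (fun ω => Real.exp (l * (G t k ω - μ k) - l ^ 2 / 8)) P ∧
      ∫ ω, Real.exp (l * (G t k ω - μ k) - l ^ 2 / 8) ∂P ≤ 1 := by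
  have hmean : ∫ ω, G t k ω ∂P = μ k := by rw [(henv.ident_G t k).integral_eq, henv.mean_G k]
  have h := hasSubgaussianMGF_of_mem_Icc (henv.measurable_G t k).aemeasurable
    (Filter.Eventually.of_forall (henv.G_mem t k) : ∀ᵐ ω ∂P, G t k ω ∈ Set.Icc (0 : ℝ) 1)
  rw [hmean] at h
  simp_rw [Real.exp_sub]
  refine ⟨(h.integrable_exp_mul l).div_const _, ?_⟩
  rw [integral_div, div_le_one (Real.exp_pos _)]
  refine (h.mgf_le l).trans (Real.exp_le_exp.2 (le_of_eq ?_))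
  simp
  ring

/-- The exponential process that controls the deviation of the collected rewards from their mean. -/
noncomputable def expDeviation (μ : Fin K → ℝ) (G : ℕ → Fin K → Ω → ℝ) (ξ : ℕ → Ω → S)
    (B : ℕ → Fin K → ℝ → S → ℝ) (X : ℕ → Ω → Fin K → ℝ) (l : ℝ) (t : ℕ) (k : Fin K) (ω : Ω) : ℝ :=
  Real.exp (l * (collected G ξ B X t k ω - μ k * completions ξ B X t k ω)
    - l ^ 2 / 8 * completions ξ B X t k ω)

lemma measurable_expDeviation_past (henv : IsBudgetEnv P F μ G ξ B) {t : ℕ}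
    (hX : ∀ s < t, Measurable[past G ξ s] (X s)) (k : Fin K) (l : ℝ) :
    Measurable[past G ξ t] (expDeviation μ G ξ B X l t k) := by
  have h1 := measurable_completions_past henv hX k
  have h2 := measurable_collected_past henv hX k
  exact (((h2.sub (h1.const_mul _)).const_mul _).sub (h1.const_mul _)).exp

/-- Supermartingale argument: a round without completion leaves the process unchanged, and a
completion multiplies it by a factor of mean at most 1, independent of the past and of the
completion. -/
lemma integral_expDeviation_le [IsProbabilityMeasure P] (henv : IsBudgetEnv P F μ G ξ B) {t : ℕ}
    (hX : ∀ s < t, Measurable[past G ξ s] (X s))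
    (hmem : ∀ s < t, ∀ ω, X s ω ∈ stdSimplex ℝ (Fin K)) (k : Fin K) (l : ℝ) :
    Integrable (expDeviation μ G ξ B X l t k) P ∧ ∫ ω, expDeviation μ G ξ B X l t k ω ∂P ≤ 1 := by
  induction t with
  | zero =>
    have h : expDeviation μ G ξ B X l 0 k = fun _ => 1 := by
      ext ω
      simp [expDeviation, completions, collected]
    simp [h]
  | succ t ih =>
    have hX' : ∀ s < t, Measurable[past G ξ s] (X s) := fun s hs => hX s (hs.trans t.lt_succ_self)
    obtain ⟨hint, hle⟩ := ih hX' fun s hs => hmem s (hs.trans t.lt_succ_self)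
    set Z := expDeviation μ G ξ B X l t k with hZ
    set b : Ω → ℝ := fun ω => B t k (X t ω k) (ξ t ω) with hb
    set e : Ω → ℝ := fun ω => Real.exp (l * (G t k ω - μ k) - l ^ 2 / 8) with he
    have hb01 : ∀ ω, b ω = 0 ∨ b ω = 1 := indicator_mem henv (hmem t t.lt_succ_self) k
    obtain ⟨heint, hele⟩ := integral_exp_reward_le henv t k l
    have hbm : Measurable[pastWithNoise G ξ t] b :=
      measurable_indicator_of_measurable (henv.measurable_B t k)
        ((hX t t.lt_succ_self).mono (past_le_pastWithNoise t) le_rfl)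
        (measurable_noise_pastWithNoise t)
    have hZm : Measurable[pastWithNoise G ξ t] Z :=
      (measurable_expDeviation_past henv hX' k l).mono (past_le_pastWithNoise t) le_rfl
    have hple : pastWithNoise G ξ t ≤ ‹MeasurableSpace Ω› :=
      ((measurable_pastData henv t).prodMk (henv.measurable_ξ t)).comap_le
    have hbm' : Measurable b := hbm.mono hple le_rfl
    have hZb : Integrable (fun ω => Z ω * b ω) P := by
      refine hint.mul_bdd (c := 1) hbm'.aestronglyMeasurable (Filter.Eventually.of_forall fun ω => ?_)
      rcases hb01 ω with h | h <;> simp [h]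
    have hind : IndepFun (fun ω => Z ω * b ω) e P :=
      (indepFun_of_measurable_pastWithNoise henv (hZm.mul hbm) k).comp (φ := id)
        (ψ := fun g => Real.exp (l * (g - μ k) - l ^ 2 / 8)) measurable_id (by fun_prop)
    have hprod : Integrable (fun ω => Z ω * b ω * e ω) P := hind.integrable_mul hZb heint
    have hsub : Integrable (fun ω => Z ω - Z ω * b ω) P := hint.sub hZb
    have hstep : expDeviation μ G ξ B X l (t + 1) k =
        fun ω => Z ω - Z ω * b ω + Z ω * b ω * e ω := by
      ext ω
      have h1 : completions ξ B X (t + 1) k ω = completions ξ B X t k ω + b ω :=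
        Finset.sum_range_succ _ _
      have h2 : collected G ξ B X (t + 1) k ω = collected G ξ B X t k ω + b ω * G t k ω :=
        Finset.sum_range_succ _ _
      simp only [hZ, he, expDeviation, h1, h2]
      rcases hb01 ω with h | h
      · simp [h]
      · rw [h, mul_one, sub_self, zero_add, ← Real.exp_add]
        congr 1
        ring
    rw [hstep]
    refine ⟨hsub.add hprod, ?_⟩
    beta_reduce
    rw [integral_add hsub hprod, integral_sub hint hZb,
      hind.integral_fun_mul_eq_mul_integral hZb.aestronglyMeasurable heint.aestronglyMeasurable]
    have hnn : 0 ≤ ∫ ω, Z ω * b ω ∂P := integral_nonneg fun ω => by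
      have : 0 ≤ Z ω := (Real.exp_pos _).le
      rcases hb01 ω with h | h <;> simp [h, this]
    have hele' : ∫ ω, e ω ∂P ≤ 1 := hele
    nlinarith

/-- Chernoff's bound. Fixing the count at a deterministic `n` allows the optimal tilt `√(8 L / n)`,
with exponent `2 L - L`; `σ` is the sign of the deviation. -/
lemma measureReal_deviation_le [IsProbabilityMeasure P] (henv : IsBudgetEnv P F μ G ξ B) {t : ℕ}
    (hX : ∀ s < t, Measurable[past G ξ s] (X s))
    (hmem : ∀ s < t, ∀ ω, X s ω ∈ stdSimplex ℝ (Fin K)) (k : Fin K) {L : ℝ} (hL : 0 ≤ L)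
    {n : ℕ} (hn : 1 ≤ n) {σ : ℝ} (hσ : σ ^ 2 = 1) :
    P.real {ω | completions ξ B X t k ω = n ∧
      √(n * L / 2) ≤ σ * (collected G ξ B X t k ω - μ k * n)} ≤ Real.exp (-L) := by
  have hn0 : (0 : ℝ) < n := by exact_mod_cast hn
  set l := σ * √(8 * L / n) with hl
  have hl2 : l ^ 2 = 8 * L / n := by
    rw [hl, mul_pow, hσ, one_mul, Real.sq_sqrt (by positivity)]
  obtain ⟨hint, hle⟩ := integral_expDeviation_le henv hX hmem k l
  have hmarkov : Real.exp L * P.real {ω | Real.exp L ≤ expDeviation μ G ξ B X l t k ω} ≤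
      ∫ ω, expDeviation μ G ξ B X l t k ω ∂P := mul_meas_ge_le_integral_of_nonneg
    (Filter.Eventually.of_forall fun ω => (Real.exp_pos _).le) hint (Real.exp L)
  have hsub : {ω | completions ξ B X t k ω = n ∧
      √(n * L / 2) ≤ σ * (collected G ξ B X t k ω - μ k * n)} ⊆
      {ω | Real.exp L ≤ expDeviation μ G ξ B X l t k ω} := by
    rintro ω ⟨hω1, hω2⟩
    refine Real.exp_le_exp.2 ?_
    rw [hω1, hl2]
    have h1 : l * (collected G ξ B X t k ω - μ k * n) =
        √(8 * L / n) * (σ * (collected G ξ B X t k ω - μ k * n)) := by rw [hl]; ring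
    have h2 : √(8 * L / n) * √(n * L / 2) = 2 * L := by
      rw [← Real.sqrt_mul (by positivity), show 8 * L / n * (n * L / 2) = (2 * L) ^ 2 by
        field_simp; ring, Real.sqrt_sq (by positivity)]
    have h3 := mul_le_mul_of_nonneg_left hω2 (Real.sqrt_nonneg (8 * L / n))
    have h4 : 8 * L / n / 8 * n = L := by field_simp
    rw [h1, h4]
    linarith
  have := measureReal_mono (μ := P) hsub
  rw [Real.exp_neg, ← one_div, le_div_iff₀ (Real.exp_pos _)]
  nlinarith [Real.exp_pos L]

/-- The event that the empirical mean reward of task `k` after `t` rounds is off by more than the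
width of its confidence interval. -/
def badEvent (L : ℝ) (μ : Fin K → ℝ) (G : ℕ → Fin K → Ω → ℝ) (ξ : ℕ → Ω → S)
    (B : ℕ → Fin K → ℝ → S → ℝ) (X : ℕ → Ω → Fin K → ℝ) (t : ℕ) (k : Fin K) : Set Ω :=
  {ω | √(L / (1 + completions ξ B X t k ω)) <
    |collected G ξ B X t k ω / completions ξ B X t k ω - μ k|}

lemma measurableSet_badEvent (henv : IsBudgetEnv P F μ G ξ B) {t : ℕ} (L : ℝ)
    (hX : ∀ s < t, Measurable[past G ξ s] (X s)) (k : Fin K) :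
    MeasurableSet (badEvent L μ G ξ B X t k) := by
  have h1 := (measurable_completions_past henv hX k).mono (past_le henv t) le_rfl
  have h2 := (measurable_collected_past henv hX k).mono (past_le henv t) le_rfl
  exact measurableSet_lt ((h1.const_add 1).const_div _).sqrt ((h2.div h1).sub_const _).abs

/-- The count is random, hence a union bound over its `t` positive values and both signs. -/
lemma measureReal_badEvent_le [IsProbabilityMeasure P] (henv : IsBudgetEnv P F μ G ξ B) {t : ℕ}
    (hX : ∀ s < t, Measurable[past G ξ s] (X s))
    (hmem : ∀ s < t, ∀ ω, X s ω ∈ stdSimplex ℝ (Fin K)) (k : Fin K) {L : ℝ} (hL : 1 ≤ L) :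
    P.real (badEvent L μ G ξ B X t k) ≤ t * (2 * Real.exp (-L)) := by
  set D : ℕ → ℝ → Set Ω := fun n σ => {ω | completions ξ B X t k ω = n ∧
      √(n * L / 2) ≤ σ * (collected G ξ B X t k ω - μ k * n)} with hD
  have hsub : badEvent L μ G ξ B X t k ⊆ ⋃ n ∈ Finset.Icc 1 t, (D n 1 ∪ D n (-1)) := by
    intro ω hω
    obtain ⟨n, hnt, hn⟩ := exists_completions_eq_natCast henv hmem k ω
    simp only [badEvent, Set.mem_ofPred_eq, hn] at hω
    -- With no completion the empirical mean is `0 / 0 = 0` and the width is `√L ≥ 1 ≥ μ k`, so the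
    -- interval cannot fail.
    have hn1 : 1 ≤ n := by
      rw [Nat.one_le_iff_ne_zero]
      rintro rfl
      have hμ := mean_mem_Icc henv k
      simp only [Nat.cast_zero, div_zero, add_zero, div_one, zero_sub, abs_neg,
        abs_of_nonneg hμ.1] at hω
      have : 1 ≤ √L := Real.one_le_sqrt.2 hL
      linarith [hμ.2]
    have hn0 : (1 : ℝ) ≤ n := by exact_mod_cast hn1
    have hdev : √(n * L / 2) ≤ |collected G ξ B X t k ω - μ k * n| := by
      have h1 : collected G ξ B X t k ω - μ k * n = n * (collected G ξ B X t k ω / n - μ k) := by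
        field_simp
      rw [h1, abs_mul, abs_of_pos (by linarith : (0 : ℝ) < n)]
      refine le_trans ?_ (mul_le_mul_of_nonneg_left hω.le (by linarith))
      -- Using `1 + n` in place of `n` in the width costs at most the factor 2 that Hoeffding's
      -- bound leaves spare.
      refine Real.sqrt_le_iff.2 ⟨by positivity, ?_⟩
      rw [mul_pow, Real.sq_sqrt (by positivity), ← mul_div_assoc,
        div_le_div_iff₀ (by norm_num) (by positivity)]
      have : 0 ≤ n * L * (n - 1) := mul_nonneg (by positivity) (by linarith)
      nlinarith
    simp only [Set.mem_iUnion]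
    refine ⟨n, Finset.mem_Icc.2 ⟨hn1, hnt⟩, ?_⟩
    rcases le_abs.1 hdev with h | h
    · exact Or.inl ⟨hn, by rwa [one_mul]⟩
    · exact Or.inr ⟨hn, by rwa [neg_one_mul]⟩
  calc P.real (badEvent L μ G ξ B X t k)
      ≤ P.real (⋃ n ∈ Finset.Icc 1 t, (D n 1 ∪ D n (-1))) := measureReal_mono hsub (measure_ne_top _ _)
    _ ≤ ∑ n ∈ Finset.Icc 1 t, P.real (D n 1 ∪ D n (-1)) := measureReal_biUnion_finset_le _ _
    _ ≤ ∑ n ∈ Finset.Icc 1 t, 2 * Real.exp (-L) := by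
        refine Finset.sum_le_sum fun n hn => (measureReal_union_le _ _).trans ?_
        have hn1 := (Finset.mem_Icc.1 hn).1
        have h1 := measureReal_deviation_le henv hX hmem k (zero_le_one.trans hL) hn1
          (one_pow 2 : (1 : ℝ) ^ 2 = 1)
        have h2 := measureReal_deviation_le henv hX hmem k (zero_le_one.trans hL) hn1
          (neg_one_sq : (-1 : ℝ) ^ 2 = 1)
        linarith
    _ = t * (2 * Real.exp (-L)) := by simp

end Concentration

/-! ### Summing the losses of the rounds -/

section Regret

variable {K : ℕ} {Ω S : Type*} [MeasurableSpace Ω] [MeasurableSpace S] {P : Measure Ω}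
  {F : Fin K → ℝ → ℝ} {μ : Fin K → ℝ} {G : ℕ → Fin K → Ω → ℝ}
  {ξ : ℕ → Ω → S} {B : ℕ → Fin K → ℝ → S → ℝ} {X : ℕ → Ω → Fin K → ℝ} {a : Fin K → ℝ}

lemma sum_indicator_div_le (henv : IsBudgetEnv P F μ G ξ B) {t : ℕ}
    (hmem : ∀ s < t, ∀ ω, X s ω ∈ stdSimplex ℝ (Fin K)) (k : Fin K) (ω : Ω) :
    ∑ s ∈ Finset.range t, 1 / (1 + completions ξ B X s k ω) * B s k (X s ω k) (ξ s ω) ≤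
      2 * Real.log (1 + completions ξ B X t k ω) := by
  induction t with
  | zero => simp [completions]
  | succ t ih =>
    have hmem' := fun s (hs : s < t) => hmem s (hs.trans t.lt_succ_self)
    have hsucc : completions ξ B X (t + 1) k ω =
        completions ξ B X t k ω + B t k (X t ω k) (ξ t ω) := Finset.sum_range_succ _ _
    rw [Finset.sum_range_succ, hsucc]
    have hnn := completions_nonneg henv hmem' k ω
    have h := ih hmem'
    rcases indicator_mem henv (hmem t t.lt_succ_self) k ω with h0 | h1
    · rw [h0]; simpa using h
    · rw [h1, mul_one]
      linarith [inv_one_add_le_log_sub hnn]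

/-- The weight `1 / (1 + N)` is predictable, so `F k` may be exchanged for the indicator; the sum
then telescopes on each path, with `N ≤ T`. -/
lemma sum_integral_div_le [IsProbabilityMeasure P] (henv : IsBudgetEnv P F μ G ξ B) {T : ℕ}
    (hX : ∀ s < T, Measurable[past G ξ s] (X s))
    (hmem : ∀ s < T, ∀ ω, X s ω ∈ stdSimplex ℝ (Fin K)) (k : Fin K) :
    ∑ t ∈ Finset.range T, ∫ ω, 1 / (1 + completions ξ B X t k ω) * F k (X t ω k) ∂P ≤
      2 * Real.log (1 + T) := by
  have hw : ∀ t ∈ Finset.range T, Measurable[past G ξ t] fun ω => 1 / (1 + completions ξ B X t k ω) :=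
    fun t ht => ((measurable_completions_past henv (fun s hs =>
      hX s (hs.trans (Finset.mem_range.1 ht))) k).const_add 1).const_div _
  have hw1 : ∀ t ∈ Finset.range T, ∀ ω, |1 / (1 + completions ξ B X t k ω)| ≤ 1 := by
    intro t ht ω
    have := completions_nonneg henv (fun s hs => hmem s (hs.trans (Finset.mem_range.1 ht))) k ω
    rw [abs_of_nonneg (by positivity), div_le_one (by positivity)]
    linarith
  have hint : ∀ t ∈ Finset.range T,
      Integrable (fun ω => 1 / (1 + completions ξ B X t k ω) * B t k (X t ω k) (ξ t ω)) P := by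
    intro t ht
    have ht' := Finset.mem_range.1 ht
    refine Integrable.of_bound (C := 1) ?_ (Filter.Eventually.of_forall fun ω => ?_)
    · exact (((hw t ht).mono (past_le henv t) le_rfl).mul
        (measurable_indicator_of_measurable (henv.measurable_B t k)
          ((hX t ht').mono (past_le henv t) le_rfl) (henv.measurable_ξ t))).aestronglyMeasurable
    · have := hw1 t ht ω
      rcases indicator_mem henv (hmem t ht') k ω with h | h
      · simp [h]
      · rw [h, mul_one]; exact this
  calc ∑ t ∈ Finset.range T, ∫ ω, 1 / (1 + completions ξ B X t k ω) * F k (X t ω k) ∂P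
      = ∑ t ∈ Finset.range T,
          ∫ ω, 1 / (1 + completions ξ B X t k ω) * B t k (X t ω k) (ξ t ω) ∂P :=
        Finset.sum_congr rfl fun t ht => (integral_mul_indicator henv (hw t ht) (hw1 t ht)
          (hX t (Finset.mem_range.1 ht)) (hmem t (Finset.mem_range.1 ht))).symm
    _ = ∫ ω, ∑ t ∈ Finset.range T,
          1 / (1 + completions ξ B X t k ω) * B t k (X t ω k) (ξ t ω) ∂P :=
        (integral_finsetSum _ hint).symm
    _ ≤ ∫ _, 2 * Real.log (1 + T) ∂P := by
        refine integral_mono (integrable_finsetSum _ hint) (integrable_const _) fun ω => ?_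
        refine (sum_indicator_div_le henv hmem k ω).trans ?_
        obtain ⟨n, hn, h⟩ := exists_completions_eq_natCast henv hmem k ω
        rw [h]
        have : (n : ℝ) ≤ T := by exact_mod_cast hn
        gcongr
    _ = 2 * Real.log (1 + T) := by simp

/-- The regret of a round is bounded by squared confidence widths weighted with the completion
probabilities, unless one of the confidence intervals misses its mean reward. -/
lemma round_regret_le [IsProbabilityMeasure P] (ha : ∀ k, a k ∈ Set.Ioo (0 : ℝ) 1)
    (hF : ∀ k, ∀ x ∈ Set.Icc (0 : ℝ) 1, F k x = x ^ a k) (hμ : ∀ k, 0 < μ k)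
    (henv : IsBudgetEnv P F μ G ξ B) {x : Fin K → ℝ} (hx : x ∈ stdSimplex ℝ (Fin K))
    (hmax : IsMaxOn (powerValue a μ) (stdSimplex ℝ (Fin K)) x) {T : ℕ} {δ : ℝ}
    (hδ : 0 < Real.log (2 / δ)) (hrun : IsUCBRun T δ F G ξ B X) {t : ℕ} (ht : t < T) (ω : Ω) :
    powerValue a μ x - powerValue a μ (X t ω) ≤
      ∑ k, (4 * Real.log (2 / δ) * gapWeight a μ x k *
          (1 / (1 + completions ξ B X t k ω) * F k (X t ω k))
        + K * (badEvent (Real.log (2 / δ)) μ G ξ B X t k).indicator 1 ω) := by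
  classical
  set L := Real.log (2 / δ)
  have hmem : ∀ s < t, ∀ ω, X s ω ∈ stdSimplex ℝ (Fin K) := fun s hs ω => (hrun s (hs.trans ht) ω).1
  have hXt := (hrun t ht ω).1
  have hN := fun k => completions_nonneg henv hmem k ω
  have hpow : ∀ k, F k (X t ω k) = X t ω k ^ a k := fun k => hF k _ (mem_Icc_of_mem_simplex hXt k)
  have hpow0 : ∀ k, 0 ≤ X t ω k ^ a k := fun k => Real.rpow_nonneg (hXt.1 k) _
  have hterm : ∀ k, 0 ≤ 4 * L * gapWeight a μ x k *
      (1 / (1 + completions ξ B X t k ω) * F k (X t ω k)) := by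
    intro k
    have h1 := gapWeight_nonneg ha hμ hx k
    have h2 := hN k
    have h3 := hpow0 k
    rw [hpow]
    positivity
  have hind : ∀ k, (0 : ℝ) ≤ K * (badEvent L μ G ξ B X t k).indicator 1 ω := fun k =>
    mul_nonneg K.cast_nonneg (Set.indicator_nonneg (fun _ _ => zero_le_one) _)
  by_cases hgood : ∀ k, ω ∉ badEvent L μ G ξ B X t k
  · have habs : ∀ k, |collected G ξ B X t k ω / completions ξ B X t k ω - μ k| ≤
        √(L / (1 + completions ξ B X t k ω)) := fun k => not_lt.1 (hgood k)
    have hucb : ∀ k, ucb δ G ξ B X t k ω = collected G ξ B X t k ω / completions ξ B X t k ω +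
        √(L / (1 + completions ξ B X t k ω)) := fun k => rfl
    have hgap := value_gap_le (u := fun k => ucb δ G ξ B X t k ω) ha hμ hx hmax hXt
      (fun k => by rw [hucb]; linarith [(abs_le.1 (habs k)).1])
      (isMaxOn_powerValue hF hXt (hrun t ht ω).2 hx)
    refine hgap.trans (Finset.sum_le_sum fun k _ => ?_)
    -- An upper bound exceeds the mean by at most twice the width.
    have hsq : (ucb δ G ξ B X t k ω - μ k) ^ 2 ≤ 4 * (L / (1 + completions ξ B X t k ω)) := by
      have h1 := abs_le.1 (habs k)
      have h2 := Real.sq_sqrt (div_nonneg hδ.le (by linarith [hN k]) :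
        0 ≤ L / (1 + completions ξ B X t k ω))
      rw [← h2, hucb]
      nlinarith
    have h1 := mul_le_mul_of_nonneg_right (mul_le_mul_of_nonneg_left hsq
      (gapWeight_nonneg ha hμ hx k)) (hpow0 k)
    refine h1.trans (le_trans (le_of_eq ?_) (le_add_of_nonneg_right (hind k)))
    rw [hpow]
    ring
  · push Not at hgood
    obtain ⟨k, hk⟩ := hgood
    -- On a failure the crude loss bound `K` is paid by a single indicator.
    have h1 : powerValue a μ x ≤ K := by
      have : powerValue a μ x ≤ ∑ _k : Fin K, (1 : ℝ) := Finset.sum_le_sum fun k _ => by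
        have := (mean_mem_Icc henv k).2
        have hxk := mem_Icc_of_mem_simplex hx k
        exact mul_le_one₀ this (Real.rpow_nonneg hxk.1 _) (Real.rpow_le_one hxk.1 hxk.2 (ha k).1.le)
      simpa using this
    have h2 : 0 ≤ powerValue a μ (X t ω) :=
      Finset.sum_nonneg fun k _ => mul_nonneg (hμ k).le (hpow0 k)
    have h3 := Finset.single_le_sum (fun k _ => add_nonneg (hterm k) (hind k)) (Finset.mem_univ k)
    refine le_trans ?_ h3
    have h4 : (badEvent L μ G ξ B X t k).indicator (1 : Ω → ℝ) ω = 1 := by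
      rw [Set.indicator_of_mem hk]; rfl
    rw [h4]
    linarith [hterm k]

lemma measurable_powerValue (m : Fin K → ℝ) {x : Ω → Fin K → ℝ} (hx : Measurable x) :
    Measurable fun ω => powerValue a m (x ω) :=
  Finset.measurable_sum _ fun k _ => (((measurable_pi_apply k).comp hx).pow_const _).const_mul _

lemma integrable_powerValue [IsProbabilityMeasure P] (ha : ∀ k, a k ∈ Set.Ioo (0 : ℝ) 1)
    (m : Fin K → ℝ) {x : Ω → Fin K → ℝ} (hx : Measurable x)
    (hmem : ∀ ω, x ω ∈ stdSimplex ℝ (Fin K)) : Integrable (fun ω => powerValue a m (x ω)) P := by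
  refine Integrable.of_bound (C := ∑ k, |m k|) (measurable_powerValue m hx).aestronglyMeasurable
    (Filter.Eventually.of_forall fun ω => (Finset.abs_sum_le_sum_abs _ _).trans
      (Finset.sum_le_sum fun k _ => ?_))
  have hk := mem_Icc_of_mem_simplex (hmem ω) k
  rw [abs_mul, abs_of_nonneg (Real.rpow_nonneg hk.1 _)]
  exact mul_le_of_le_one_right (abs_nonneg _) (Real.rpow_le_one hk.1 hk.2 (ha k).1.le)

/-- The 8 is 4 from the squared width times 2 from the logarithmic sum. Each of the `K T` pairs of
task and round fails with probability at most `T δ`, at cost `K`. -/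
lemma sum_integral_regret_le [IsProbabilityMeasure P] (ha : ∀ k, a k ∈ Set.Ioo (0 : ℝ) 1)
    (hF : ∀ k, ∀ x ∈ Set.Icc (0 : ℝ) 1, F k x = x ^ a k) (hμ : ∀ k, 0 < μ k)
    (henv : IsBudgetEnv P F μ G ξ B) {x : Fin K → ℝ} (hx : x ∈ stdSimplex ℝ (Fin K))
    (hmax : IsMaxOn (powerValue a μ) (stdSimplex ℝ (Fin K)) x) {T : ℕ} {δ : ℝ} (hδ0 : 0 < δ)
    (hδ : 1 ≤ Real.log (2 / δ)) (hrun : IsUCBRun T δ F G ξ B X) :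
    ∑ t ∈ Finset.range T, ∫ ω, (powerValue a μ x - powerValue a μ (X t ω)) ∂P ≤
      8 * Real.log (2 / δ) * Real.log (1 + T) * ∑ k, gapWeight a μ x k + δ * (K * T) ^ 2 := by
  have hδ1 : 0 < Real.log (2 / δ) := by linarith
  have hX := measurable_allocation_past ha hF henv hδ1 hrun
  set L := Real.log (2 / δ) with hLdef
  have hmem : ∀ s < T, ∀ ω, X s ω ∈ stdSimplex ℝ (Fin K) := fun s hs ω => (hrun s hs ω).1
  have hexp : 2 * Real.exp (-L) = δ := by
    rw [hLdef, Real.exp_neg, Real.exp_log (by positivity)]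
    field_simp
  have hint1 : ∀ t < T, ∀ k,
      Integrable (fun ω => 1 / (1 + completions ξ B X t k ω) * F k (X t ω k)) P := by
    intro t ht k
    have hXt : Measurable (X t) := (hX t ht).mono (past_le henv t) le_rfl
    have hN : Measurable (completions ξ B X t k) := (measurable_completions_past henv
      (fun s hs => hX s (hs.trans ht)) k).mono (past_le henv t) le_rfl
    have hpow : ∀ ω, F k (X t ω k) = X t ω k ^ a k :=
      fun ω => hF k _ (mem_Icc_of_mem_simplex (hmem t ht ω) k)
    simp_rw [hpow]
    refine Integrable.of_bound (C := 1) ?_ (Filter.Eventually.of_forall fun ω => ?_)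
    · exact (((hN.const_add 1).const_div _).mul
        (((measurable_pi_apply k).comp hXt).pow_const _)).aestronglyMeasurable
    · have h1 := completions_nonneg henv (fun s hs => hmem s (hs.trans ht)) k ω
      have h2 := mem_Icc_of_mem_simplex (hmem t ht ω) k
      have h3 := Real.rpow_nonneg h2.1 (a k)
      rw [Real.norm_of_nonneg (by positivity)]
      refine mul_le_one₀ ?_ h3 (Real.rpow_le_one h2.1 h2.2 (ha k).1.le)
      rw [div_le_one (by positivity)]
      linarith
  have hbadm : ∀ t < T, ∀ k, MeasurableSet (badEvent L μ G ξ B X t k) := fun t ht k =>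
    measurableSet_badEvent henv L (fun s hs => hX s (hs.trans ht)) k
  have hint2 : ∀ t < T, ∀ k,
      Integrable ((badEvent L μ G ξ B X t k).indicator (1 : Ω → ℝ)) P := fun t ht k =>
    (integrable_const (1 : ℝ)).indicator (hbadm t ht k)
  have hround : ∀ t ∈ Finset.range T, ∫ ω, (powerValue a μ x - powerValue a μ (X t ω)) ∂P ≤
      ∑ k, (4 * L * gapWeight a μ x k *
        ∫ ω, 1 / (1 + completions ξ B X t k ω) * F k (X t ω k) ∂P + K * (T * δ)) := by
    intro t ht
    have ht := Finset.mem_range.1 ht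
    have hXt : Measurable (X t) := (hX t ht).mono (past_le henv t) le_rfl
    have hi : ∀ k, Integrable (fun ω => 4 * L * gapWeight a μ x k *
        (1 / (1 + completions ξ B X t k ω) * F k (X t ω k))
        + K * (badEvent L μ G ξ B X t k).indicator 1 ω) P := fun k =>
      ((hint1 t ht k).const_mul _).add ((hint2 t ht k).const_mul _)
    refine (integral_mono ((integrable_const _).sub (integrable_powerValue ha μ hXt (hmem t ht)))
      (integrable_finsetSum _ fun k _ => hi k)
      (round_regret_le ha hF hμ henv hx hmax hδ1 hrun ht)).trans ?_
    rw [integral_finsetSum _ fun k _ => hi k]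
    refine Finset.sum_le_sum fun k _ => ?_
    rw [integral_add ((hint1 t ht k).const_mul _) ((hint2 t ht k).const_mul _),
      integral_const_mul, integral_const_mul, integral_indicator_one (hbadm t ht k)]
    have hbad := measureReal_badEvent_le henv (fun s hs => hX s (hs.trans ht))
      (fun s hs => hmem s (hs.trans ht)) k hδ
    rw [hexp] at hbad
    have htT : (t : ℝ) ≤ T := by exact_mod_cast ht.le
    have : P.real (badEvent L μ G ξ B X t k) ≤ T * δ :=
      hbad.trans (mul_le_mul_of_nonneg_right htT hδ0.le)
    gcongr
  refine (Finset.sum_le_sum hround).trans ?_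
  rw [Finset.sum_comm]
  simp_rw [Finset.sum_add_distrib, ← Finset.mul_sum]
  refine add_le_add ?_ (le_of_eq ?_)
  · rw [Finset.mul_sum]
    refine Finset.sum_le_sum fun k _ => ?_
    have h1 := sum_integral_div_le henv hX hmem k
    have h2 := gapWeight_nonneg ha hμ hx k
    refine (mul_le_mul_of_nonneg_left h1 (by positivity)).trans (le_of_eq ?_)
    ring
  · simp only [Finset.sum_const, Finset.card_univ, Fintype.card_fin, Finset.card_range, nsmul_eq_mul]
    ring

lemma regret_eq_sum_integral [IsProbabilityMeasure P] (ha : ∀ k, a k ∈ Set.Ioo (0 : ℝ) 1)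
    (hF : ∀ k, ∀ x ∈ Set.Icc (0 : ℝ) 1, F k x = x ^ a k) {x : Fin K → ℝ}
    (hx : x ∈ stdSimplex ℝ (Fin K)) (hmax : IsMaxOn (powerValue a μ) (stdSimplex ℝ (Fin K)) x) {T : ℕ}
    (hX : ∀ t < T, Measurable (X t)) (hmem : ∀ t < T, ∀ ω, X t ω ∈ stdSimplex ℝ (Fin K)) :
    regret P F μ X T =
      ∑ t ∈ Finset.range T, ∫ ω, (powerValue a μ x - powerValue a μ (X t ω)) ∂P := by
  have hsup : sSup (allocValue μ F '' stdSimplex ℝ (Fin K)) = powerValue a μ x := by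
    refine IsGreatest.csSup_eq ⟨⟨x, hx, allocValue_eq_powerValue hF μ hx⟩, ?_⟩
    rintro _ ⟨y, hy, rfl⟩
    rw [allocValue_eq_powerValue hF μ hy]
    exact hmax hy
  have hterm : ∀ t ∈ Finset.range T, ∫ ω, (powerValue a μ x - powerValue a μ (X t ω)) ∂P =
      powerValue a μ x - ∫ ω, allocValue μ F (X t ω) ∂P := by
    intro t ht
    have ht := Finset.mem_range.1 ht
    rw [integral_sub (integrable_const _) (integrable_powerValue ha μ (hX t ht) (hmem t ht))]
    simp [allocValue_eq_powerValue hF μ (hmem t ht _)]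
  rw [regret, hsup, Finset.sum_congr rfl hterm, Finset.sum_sub_distrib]
  simp

end Regret

/-! ### Choice of constants -/

/-- For `K T ≥ 2` one has `2 / δ = 2 (K T) ^ 2 ≥ 8`, so the confidence level satisfies `L ≥ 1`. -/
lemma one_le_log_eight : 1 ≤ Real.log 8 := by
  rw [Real.le_log_iff_exp_le (by norm_num)]
  linarith [Real.exp_one_lt_d9]

theorem theoremt {K : ℕ} (F : Fin K → ℝ → ℝ) (μ : Fin K → ℝ)
    (hμ : ∀ k, μ k ≠ 0) (hF : ∀ k, IsConcavePower (F k)) :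
    ∃ C : ℝ, ∀ (Ω S : Type*) [MeasurableSpace Ω] [MeasurableSpace S]
      (P : Measure Ω) [IsProbabilityMeasure P]
      (G : ℕ → Fin K → Ω → ℝ) (ξ : ℕ → Ω → S) (B : ℕ → Fin K → ℝ → S → ℝ),
      IsBudgetEnv P F μ G ξ B →
      ∀ (T : ℕ), 2 ≤ T → ∀ (X : ℕ → Ω → Fin K → ℝ),
        IsUCBRun T (1 / ((K : ℝ) * (T : ℝ)) ^ 2) F G ξ B X →
          (∀ t < T, Integrable (fun ω => allocValue μ F (X t ω)) P) ∧
          |regret P F μ X T| ≤ C * Real.log T ^ 2 := by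
  choose a ha hFa using hF
  -- Means of [0,1]-valued rewards are nonnegative, so a nonzero `μ` with a nonpositive entry admits
  -- no environment.
  by_cases hpos : ∀ k, 0 < μ k
  swap
  · push Not at hpos
    obtain ⟨k, hk⟩ := hpos
    refine ⟨0, fun Ω S _ _ P _ G ξ B henv => ?_⟩
    exact absurd (le_antisymm hk (mean_mem_Icc henv k).1) (hμ k)
  rcases Nat.eq_zero_or_pos K with rfl | hK
  · refine ⟨0, fun Ω S _ _ P _ G ξ B henv T hT X hrun => ?_⟩
    obtain ⟨ω⟩ : Nonempty Ω := nonempty_of_isProbabilityMeasure P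
    have := (hrun 0 (by omega) ω).1.2
    simp at this
  have : Nonempty (Fin K) := ⟨⟨0, hK⟩⟩
  obtain ⟨x, hx, hmax⟩ := (isCompact_stdSimplex ℝ (Fin K)).exists_isMaxOn
    ⟨_, single_mem_stdSimplex ℝ (⟨0, hK⟩ : Fin K)⟩
    ((continuous_powerValue ha).comp (Continuous.prodMk_right μ)).continuousOn
  change IsMaxOn (powerValue a μ) _ x at hmax
  have hK1 : (1 : ℝ) ≤ K := by exact_mod_cast hK
  set A := ∑ k, gapWeight a μ x k with hA
  have hA0 : 0 ≤ A := Finset.sum_nonneg fun k _ => gapWeight_nonneg ha hpos hx k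
  have hlog2 : 0 < Real.log 2 := Real.log_pos (by norm_num)
  have hlogK : 0 ≤ Real.log (2 * (K : ℝ) ^ 2) := Real.log_nonneg (by nlinarith)
  -- Here `log (2 / δ) = log (2 K ^ 2) + 2 log T`, and `log T ≥ log 2` absorbs the first term.
  set c := Real.log (2 * (K : ℝ) ^ 2) / Real.log 2 + 2 with hc
  have hc0 : 0 ≤ c := by positivity
  -- 16 is 8 times the 2 in `log (1 + T) ≤ 2 log T`; the last summand pays for the total failure
  -- cost 1.
  refine ⟨16 * c * A + 1 / Real.log 2 ^ 2, fun Ω S _ _ P _ G ξ B henv T hT X hrun => ?_⟩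
  have hT2 : (2 : ℝ) ≤ T := by exact_mod_cast hT
  set δ : ℝ := 1 / ((K : ℝ) * (T : ℝ)) ^ 2 with hδ
  have hKT : 2 ≤ (K : ℝ) * T := by nlinarith
  have hδ0 : 0 < δ := by positivity
  have h2δ : 2 / δ = 2 * (K : ℝ) ^ 2 * (T : ℝ) ^ 2 := by
    rw [hδ]; field_simp
  have hL1 : 1 ≤ Real.log (2 / δ) := by
    refine one_le_log_eight.trans (Real.log_le_log (by norm_num) ?_)
    rw [h2δ]
    nlinarith
  have hlogT : Real.log 2 ≤ Real.log T := Real.log_le_log (by norm_num) hT2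
  have hL2 : Real.log (2 / δ) ≤ c * Real.log T := by
    rw [h2δ, Real.log_mul (by positivity) (by positivity), Real.log_pow, hc, add_mul]
    have : Real.log (2 * (K : ℝ) ^ 2) ≤ Real.log (2 * (K : ℝ) ^ 2) / Real.log 2 * Real.log T := by
      rw [div_mul_eq_mul_div, le_div_iff₀ hlog2]
      exact mul_le_mul_of_nonneg_left hlogT hlogK
    push_cast
    linarith
  have hlogT1 : Real.log (1 + T) ≤ 2 * Real.log T := by
    have : Real.log ((T : ℝ) ^ 2) = 2 * Real.log T := by simp [Real.log_pow]
    rw [← this]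
    exact Real.log_le_log (by positivity) (by nlinarith)
  have hX : ∀ t < T, Measurable (X t) := fun t ht =>
    (measurable_allocation_past ha hFa henv (by linarith) hrun t ht).mono (past_le henv t) le_rfl
  have hmem : ∀ t < T, ∀ ω, X t ω ∈ stdSimplex ℝ (Fin K) := fun t ht ω => (hrun t ht ω).1
  refine ⟨fun t ht => ?_, ?_⟩
  · simp_rw [allocValue_eq_powerValue hFa μ (hmem t ht _)]
    exact integrable_powerValue ha μ (hX t ht) (hmem t ht)
  have hreg := regret_eq_sum_integral (P := P) ha hFa hx hmax hX hmem
  have hnn : 0 ≤ regret P F μ X T := by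
    rw [hreg]
    exact Finset.sum_nonneg fun t ht => integral_nonneg fun ω =>
      sub_nonneg.2 (hmax (hmem t (Finset.mem_range.1 ht) ω))
  rw [abs_of_nonneg hnn, hreg]
  refine (sum_integral_regret_le ha hFa hpos henv hx hmax hδ0 hL1 hrun).trans ?_
  have hone : δ * (K * T) ^ 2 = 1 := by rw [hδ]; field_simp
  rw [hone, add_mul, ← hA]
  refine add_le_add ?_ ?_
  · have hlT : 0 ≤ Real.log T := by linarith
    have h1 : Real.log (2 / δ) * Real.log (1 + T) ≤ c * Real.log T * (2 * Real.log T) :=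
      mul_le_mul hL2 hlogT1 (Real.log_nonneg (by linarith)) (by positivity)
    have h2 := mul_le_mul_of_nonneg_right h1 hA0
    nlinarith
  · rw [div_mul_eq_mul_div, one_mul, le_div_iff₀ (by positivity), one_mul]
    gcongr
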